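/- Let $\alpha=(\alpha_n)_{n\ge 0}$ be a non-negative, (not necessarily strictly) increasing sequence of real numbers with $\lim_{n\to\infty}\alpha_n=\infty$ and $\lim_{n\to\infty}(\alpha_{n+1}-\alpha_n)=l$ for some $l\in(0,\infty)$. Let $$\Lambda_\infty(\alpha)=\Big\{x=(x_n)_{n\ge 0}\in\mathbb{C}^{\mathbb{N}_0}:\ |x|_k^2:=\sum_{n=0}^\infty |x_n|^2e^{2k\alpha_n}<\infty\ \text{ for all } k\in\{1,2,\dots\}\Big\},$$ with the locally convex topology generated by the norms $|\cdot|_k$, $k\ge 1$. Let $r,s\in\mathbb{R}\setminus\{0\}$ and let $B(r,s)$ be the continuous linear operator on $\Lambda_\infty(\alpha)$ given by $(B(r,s)x)_n=s\,x_{n-1}+r\,x_n$ for $n\ge 0$, where $x_{-1}:=0$. Then $T=B(r,s)$ has none of the following properties: - $T$ is power bounded, i.e. the set $\{T^n:n\ge 0\}$ is equicontinuous; - $T$ is mean ergodic, i.e. the Cesàro means $T_{[n]}=\frac1n\sum_{m=1}^n T^m$, $n\ge1$, converge pointwise on $\Lambda_\infty(\alpha)$ to a continuous linear operator; - $T$ is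 uniformly mean ergodic, i.e. the $T_{[n]}$ converge to a continuous linear operator uniformly on the bounded subsets of $\Lambda_\infty(\alpha)$; - $T$ is supercyclic, i.e. there is $x\in\Lambda_\infty(\alpha)$ such that $\{\lambda T^nx:\ n\ge 0,\ \lambda\in\mathbb{C}\}$ is dense in $\Lambda_\infty(\alpha)$. -/

import Mathlib

open Filter Topology

noncomputable section

/-! ### Operators on complex topological vector spaces -/

section Operators

variable {E : Type*} [AddCommGroup E] [Module ℂ E] [UniformSpace E] [IsUniformAddGroup E]
  [ContinuousConstSMul ℂ E]

/-- `T` is power bounded: the set of its iterates `T ^ n`, `n ≥ 0`, is equicontinuous. -/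
def IsPowerBounded (T : E →L[ℂ] E) : Prop :=
  Equicontinuous (fun (n : ℕ) (x : E) => (T ^ n) x)

/-- The Cesàro means `T_[n] = (1 / n) ∑_{m = 1}^n T ^ m` (relevant for `n ≥ 1`). -/
def cesaroMean (T : E →L[ℂ] E) (n : ℕ) : E →L[ℂ] E :=
  ((n : ℂ)⁻¹) • ∑ m ∈ Finset.Icc 1 n, T ^ m

/-- `T` is mean ergodic: the Cesàro means converge to some continuous linear operator for the
topology of pointwise convergence. -/
def IsMeanErgodic (T : E →L[ℂ] E) : Prop :=
  ∃ P : E →L[ℂ] E, ∀ x : E, Tendsto (fun n : ℕ => cesaroMean T n x) atTop (𝓝 (P x))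

/-- `T` is uniformly mean ergodic: the Cesàro means converge to some continuous linear operator
uniformly on bounded sets (this is the topology that Mathlib puts on `E →L[ℂ] E`). -/
def IsUniformlyMeanErgodic (T : E →L[ℂ] E) : Prop :=
  ∃ P : E →L[ℂ] E, Tendsto (fun n : ℕ => cesaroMean T n) atTop (𝓝 P)

/-- `T` is supercyclic: some projective orbit `{c T ^ n x : n ≥ 0, c ∈ ℂ}` is dense. -/
def IsSupercyclic (T : E →L[ℂ] E) : Prop :=
  ∃ x : E, Dense {y : E | ∃ (n : ℕ) (c : ℂ), y = c • (T ^ n) x}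

end Operators

/-! ### Power series spaces of infinite type -/

/-- The `n`-th term `|x_n| ^ 2 e ^ (2 k α_n)` of the series defining `|x|_k ^ 2`. -/
def pssTerm (α : ℕ → ℝ) (k : ℕ+) (x : ℕ → ℂ) (n : ℕ) : ℝ :=
  ‖x n‖ ^ 2 * Real.exp (2 * (k : ℝ) * α n)

theorem pssTerm_nonneg (α : ℕ → ℝ) (k : ℕ+) (x : ℕ → ℂ) (n : ℕ) : 0 ≤ pssTerm α k x n := by
  unfold pssTerm; positivity

/-- The weighted term as the square of the norm of `e ^ (k α_n) x_n`. -/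
theorem pssTerm_eq (α : ℕ → ℝ) (k : ℕ+) (x : ℕ → ℂ) (n : ℕ) :
    pssTerm α k x n = (‖x n‖ * Real.exp ((k : ℝ) * α n)) ^ 2 := by
  unfold pssTerm
  rw [mul_pow, ← Real.exp_nat_mul]
  push_cast
  ring_nf

theorem pssTerm_add_summable_le (α : ℕ → ℝ) (k : ℕ+) {x y : ℕ → ℂ}
    (hx : Summable (pssTerm α k x)) (hy : Summable (pssTerm α k y)) :
    Summable (pssTerm α k (x + y)) ∧
      √(∑' n, pssTerm α k (x + y) n) ≤ √(∑' n, pssTerm α k x n) + √(∑' n, pssTerm α k y n) := by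
  have key := Real.Lp_add_le_tsum_of_nonneg (p := 2) (by norm_num)
    (f := fun n => ‖x n‖ * Real.exp ((k : ℝ) * α n))
    (g := fun n => ‖y n‖ * Real.exp ((k : ℝ) * α n))
    (fun n => by positivity) (fun n => by positivity)
    (by simpa [← pssTerm_eq] using hx) (by simpa [← pssTerm_eq] using hy)
  simp only [Real.rpow_ofNat, ← pssTerm_eq, ← Real.sqrt_eq_rpow] at key
  obtain ⟨h1, h2⟩ := key
  have hle : ∀ n, pssTerm α k (x + y) n ≤
      (‖x n‖ * Real.exp ((k : ℝ) * α n) + ‖y n‖ * Real.exp ((k : ℝ) * α n)) ^ 2 := by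
    intro n
    rw [pssTerm_eq, ← add_mul]
    gcongr
    exact norm_add_le _ _
  have hs : Summable (pssTerm α k (x + y)) :=
    Summable.of_nonneg_of_le (pssTerm_nonneg α k _) hle h1
  exact ⟨hs, (Real.sqrt_le_sqrt (hs.tsum_le_tsum hle h1)).trans h2⟩

theorem pssTerm_smul (α : ℕ → ℝ) (k : ℕ+) (c : ℂ) (x : ℕ → ℂ) :
    pssTerm α k (c • x) = fun n => ‖c‖ ^ 2 * pssTerm α k x n := by
  funext n
  simp only [pssTerm, Pi.smul_apply, smul_eq_mul, norm_mul]
  ring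

/-- The sequences `x` with `|x|_k < ∞` for all `k ≥ 1`, as a subspace of all sequences. -/
def pssSubmodule (α : ℕ → ℝ) : Submodule ℂ (ℕ → ℂ) where
  carrier := {x | ∀ k : ℕ+, Summable (pssTerm α k x)}
  add_mem' hx hy k := (pssTerm_add_summable_le α k (hx k) (hy k)).1
  zero_mem' k := by
    have : pssTerm α k 0 = 0 := by funext n; simp [pssTerm]
    rw [this]; exact summable_zero
  smul_mem' c x hx k := by
    rw [pssTerm_smul]; exact (hx k).mul_left _

/-- The power series space `Λ_∞(α)` of infinite type. It is a separate type, so that it does not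
inherit the topology of coordinatewise convergence; its topology is given below. -/
def PowerSeriesSpace (α : ℕ → ℝ) : Type := pssSubmodule α

namespace PowerSeriesSpace

variable (α : ℕ → ℝ)

instance : AddCommGroup (PowerSeriesSpace α) := inferInstanceAs (AddCommGroup (pssSubmodule α))

instance : Module ℂ (PowerSeriesSpace α) := inferInstanceAs (Module ℂ (pssSubmodule α))

instance : CoeFun (PowerSeriesSpace α) (fun _ => ℕ → ℂ) := ⟨fun x => x.1⟩

/-- The seminorm `|x|_k = (∑_n |x_n| ^ 2 e ^ (2 k α_n)) ^ (1 / 2)` on `Λ_∞(α)`. -/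
def seminorm (k : ℕ+) : Seminorm ℂ (PowerSeriesSpace α) :=
  Seminorm.of (fun x => √(∑' n, pssTerm α k x n))
    (fun x y => (pssTerm_add_summable_le α k (x.2 k) (y.2 k)).2)
    (fun c x => by
      change √(∑' n, pssTerm α k (c • x.1) n) = _
      rw [pssTerm_smul, tsum_mul_left, Real.sqrt_mul (by positivity),
        Real.sqrt_sq (norm_nonneg _)])

/-- The sequence `(|·|_k)`, `k ≥ 1`, of seminorms. -/
def seminormFamily : SeminormFamily ℂ (PowerSeriesSpace α) ℕ+ := fun k => seminorm α k

/-- The topology of `Λ_∞(α)` is the locally convex topology generated by the seminorms `|·|_k`,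
`k ≥ 1`. It is given through its translation invariant uniform structure. -/
instance : UniformSpace (PowerSeriesSpace α) :=
  (seminormFamily α).addGroupFilterBasis.uniformSpace

instance : IsUniformAddGroup (PowerSeriesSpace α) :=
  (seminormFamily α).addGroupFilterBasis.isUniformAddGroup

theorem withSeminorms : WithSeminorms (seminormFamily α) := ⟨rfl⟩

instance : ContinuousSMul ℂ (PowerSeriesSpace α) := (withSeminorms α).continuousSMul

end PowerSeriesSpace

/-! ### The generalized difference operator -/

/-- The generalized difference operator on the space of all sequences:
`(B(r,s) x)_n = s x_{n-1} + r x_n`, with `x_{-1} = 0`. -/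
def diffOpSeq (r s : ℝ) : (ℕ → ℂ) →ₗ[ℂ] (ℕ → ℂ) where
  toFun x n := (s : ℂ) * (if n = 0 then 0 else x (n - 1)) + (r : ℂ) * x n
  map_add' x y := by
    funext n
    by_cases h : n = 0 <;> simp [h] <;> ring
  map_smul' c x := by
    funext n
    by_cases h : n = 0 <;> simp [h] <;> ring

theorem pssTerm_diffOpSeq (α : ℕ → ℝ) (r s : ℝ) {M : ℝ} (hM : ∀ n, α (n + 1) - α n ≤ M)
    (k : ℕ+) {x : ℕ → ℂ} (hx : Summable (pssTerm α k x)) :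
    Summable (pssTerm α k (diffOpSeq r s x)) ∧
      ∑' n, pssTerm α k (diffOpSeq r s x) n ≤
        (2 * s ^ 2 * Real.exp (2 * (k : ℝ) * M) + 2 * r ^ 2) * ∑' n, pssTerm α k x n := by
  set C : ℝ := Real.exp (2 * (k : ℝ) * M) with hC
  -- the shifted sequence of terms
  let g : ℕ → ℝ := fun n => if n = 0 then 0 else pssTerm α k x (n - 1)
  have hg1 : (fun n => g (n + 1)) = pssTerm α k x := by funext n; simp [g]
  have hg : Summable g := (summable_nat_add_iff 1).1 (by rw [hg1]; exact hx)
  have hgs : ∑' n, g n = ∑' n, pssTerm α k x n := by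
    rw [hg.tsum_eq_zero_add]; simp [g]
  have hle : ∀ n, pssTerm α k (diffOpSeq r s x) n ≤
      2 * s ^ 2 * C * g n + 2 * r ^ 2 * pssTerm α k x n := by
    intro n
    have hsq : ∀ a b : ℂ, ‖a + b‖ ^ 2 ≤ 2 * ‖a‖ ^ 2 + 2 * ‖b‖ ^ 2 := by
      intro a b
      have := norm_add_le a b
      nlinarith [norm_nonneg (a + b), sq_nonneg (‖a‖ - ‖b‖), norm_nonneg a, norm_nonneg b]
    have h := hsq ((s : ℂ) * (if n = 0 then 0 else x (n - 1))) ((r : ℂ) * x n)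
    have hE := Real.exp_pos (2 * (k : ℝ) * α n)
    have h' := mul_le_mul_of_nonneg_right h hE.le
    simp only [norm_mul, mul_pow, Complex.norm_real, Real.norm_eq_abs, sq_abs] at h'
    refine le_trans (by simpa [pssTerm, diffOpSeq] using h') ?_
    rcases n with _ | n
    · simp only [if_true, norm_zero, g, pssTerm]
      nlinarith
    · simp only [Nat.add_eq_zero_iff, one_ne_zero, and_false, if_false, Nat.add_sub_cancel, g,
        pssTerm]
      have hexp : Real.exp (2 * (k : ℝ) * α (n + 1)) ≤ C * Real.exp (2 * (k : ℝ) * α n) := by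
        rw [hC, ← Real.exp_add]
        apply Real.exp_le_exp.2
        have hk : (0 : ℝ) ≤ 2 * (k : ℝ) := by positivity
        nlinarith [hM n]
      have := mul_le_mul_of_nonneg_left hexp (by positivity : 0 ≤ 2 * s ^ 2 * ‖x n‖ ^ 2)
      nlinarith
  have hs1 : Summable (fun n => 2 * s ^ 2 * C * g n + 2 * r ^ 2 * pssTerm α k x n) :=
    (hg.mul_left _).add (hx.mul_left _)
  have hs : Summable (pssTerm α k (diffOpSeq r s x)) :=
    Summable.of_nonneg_of_le (pssTerm_nonneg α k _) hle hs1
  refine ⟨hs, (hs.tsum_le_tsum hle hs1).trans_eq ?_⟩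
  rw [(hg.mul_left _).tsum_add (hx.mul_left _), tsum_mul_left, tsum_mul_left, hgs]
  ring

/-- `B(r,s)` as a linear map of `Λ_∞(α)`, when the gaps `α_{n+1} - α_n` are bounded above. -/
def diffOpLin (α : ℕ → ℝ) (r s : ℝ) (hα : BddAbove (Set.range fun n => α (n + 1) - α n)) :
    PowerSeriesSpace α →ₗ[ℂ] PowerSeriesSpace α :=
  (diffOpSeq r s).restrict (p := pssSubmodule α) (q := pssSubmodule α) (fun _ hx k =>
    (pssTerm_diffOpSeq α r s (M := hα.some) (fun n => hα.some_mem ⟨n, rfl⟩) k (hx k)).1)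

theorem diffOpLin_continuous (α : ℕ → ℝ) (r s : ℝ)
    (hα : BddAbove (Set.range fun n => α (n + 1) - α n)) : Continuous (diffOpLin α r s hα) := by
  refine WithSeminorms.continuous_of_isBounded (PowerSeriesSpace.withSeminorms α)
    (PowerSeriesSpace.withSeminorms α) _ fun k => ?_
  have hM : ∀ n, α (n + 1) - α n ≤ hα.some := fun n => hα.some_mem ⟨n, rfl⟩
  let D : ℝ := 2 * s ^ 2 * Real.exp (2 * (k : ℝ) * hα.some) + 2 * r ^ 2
  refine ⟨{k}, ⟨√D, Real.sqrt_nonneg _⟩, fun x => ?_⟩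
  have h := Real.sqrt_le_sqrt (pssTerm_diffOpSeq α r s hM k (x.2 k)).2
  rw [Real.sqrt_mul (by positivity)] at h
  rw [Finset.sup_singleton]
  exact h

/-- `B(r,s)` as a continuous linear operator on `Λ_∞(α)`, when the gaps `α_{n+1} - α_n` are
bounded above. -/
def diffOp (α : ℕ → ℝ) (r s : ℝ) (hα : BddAbove (Set.range fun n => α (n + 1) - α n)) :
    PowerSeriesSpace α →L[ℂ] PowerSeriesSpace α :=
  ⟨diffOpLin α r s hα, diffOpLin_continuous α r s hα⟩

end

/-! ### Dynamical obstructions from eigenvalues of the transpose -/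

section Eigenfunctional

/-! Since `α` grows at least linearly, the weights `e ^ (k α_n)` beat every geometric sequence, so
`x ∈ Λ_∞(α)` defines an entire function `f_x(w) = ∑ x_n w ^ n`. The operator `B(r,s)` becomes
multiplication by `r + s w`. Evaluation at `w` is thus a continuous eigenfunctional with eigenvalue
`r + s w` (`evalFunctional_diffOp`), and as `s ≠ 0` every `c ∈ ℂ` is attained, at `w = (c - r) / s`.

The eigenvalue `2` excludes power boundedness and mean ergodicity, hence also uniform mean
ergodicity. For supercyclicity, pair it with the eigenvalue `1`: along a projective orbit the ratio
of the two evaluations stays bounded, which contradicts density. -/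

theorem eigenfunctional_pow_apply {E : Type*} [AddCommGroup E] [Module ℂ E] [TopologicalSpace E]
    {T : E →L[ℂ] E} {φ : E →L[ℂ] ℂ} {c : ℂ} (h : ∀ x, φ (T x) = c * φ x) (n : ℕ) (x : E) :
    φ ((T ^ n) x) = c ^ n * φ x := by
  induction n with
  | zero => simp
  | succ n ih => rw [pow_succ', mul_apply_eq_comp, h, ih, pow_succ']; ring

variable {E : Type*} [AddCommGroup E] [Module ℂ E] [UniformSpace E] [IsUniformAddGroup E]
  {T : E →L[ℂ] E} {φ : E →L[ℂ] ℂ} {c : ℂ}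

theorem eigenfunctional_cesaroMean_apply [ContinuousConstSMul ℂ E]
    (h : ∀ x, φ (T x) = c * φ x) (n : ℕ) (x : E) :
    φ (cesaroMean T n x) = (n : ℂ)⁻¹ * ((∑ m ∈ Finset.Icc 1 n, c ^ m) * φ x) := by
  simp only [cesaroMean, smul_apply, sum_apply, map_smul,
    map_sum, eigenfunctional_pow_apply h, Finset.sum_mul, smul_eq_mul]

/-- An operator whose transpose has an eigenvalue of modulus larger than one is not power
bounded. -/
theorem not_isPowerBounded_of_eigenfunctional [ContinuousSMul ℂ E] (hc : 1 < ‖c‖)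
    (h : ∀ x, φ (T x) = c * φ x) {x₀ : E} (hx₀ : φ x₀ ≠ 0) : ¬ IsPowerBounded T := by
  intro hT
  have hφ : UniformContinuous φ := φ.uniformContinuous
  have hU : {p : E × E | dist (φ p.1) (φ p.2) < 1} ∈ uniformity E :=
    hφ (Metric.dist_mem_uniformity one_pos)
  have hV := hT 0 _ hU
  -- The neighbourhood of `0` given by equicontinuity contains a nonzero multiple `δ • x₀`, along
  -- which `φ ∘ T ^ n` grows like `‖c‖ ^ n`.
  have hlim : Tendsto (fun δ : ℂ => δ • x₀) (𝓝[≠] 0) (𝓝 0) := by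
    have : Continuous fun δ : ℂ => δ • x₀ := by fun_prop
    simpa using (this.tendsto 0).mono_left nhdsWithin_le_nhds
  obtain ⟨δ, hδ, hδ0⟩ := ((hlim.eventually hV).and self_mem_nhdsWithin).exists
  have hpos : 0 < ‖δ • φ x₀‖ := norm_pos_iff.2 (smul_ne_zero hδ0 hx₀)
  obtain ⟨n, hn⟩ := ((tendsto_pow_atTop_atTop_of_one_lt hc).atTop_mul_const hpos
    |>.eventually_ge_atTop 1).exists
  have h1 := hδ n
  simp only [Set.mem_ofPred_eq, map_zero, dist_zero_left, eigenfunctional_pow_apply h, map_smul,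
    norm_smul, norm_mul, norm_pow] at h1 hn
  linarith

/-- An operator whose transpose has an eigenvalue of modulus larger than one is not mean
ergodic. -/
theorem not_isMeanErgodic_of_eigenfunctional [ContinuousConstSMul ℂ E] (hc : 1 < ‖c‖)
    (h : ∀ x, φ (T x) = c * φ x) {x₀ : E} (hx₀ : φ x₀ ≠ 0) : ¬ IsMeanErgodic T := by
  rintro ⟨P, hP⟩
  have hc0 : c ≠ 0 := norm_pos_iff.1 (one_pos.trans hc)
  have ha := (φ.continuous.tendsto _).comp (hP x₀)
  set a : ℕ → ℂ := φ ∘ fun n => cesaroMean T n x₀ with ha_def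
  -- Consecutive partial sums `n a_n` differ by `c ^ (n + 1) φ x₀`; dividing by `n + 1` leaves a
  -- left side that tends to `0` whenever `a` converges.
  have hstep : ∀ n : ℕ, a (n + 1) - (n / (n + 1 : ℂ)) * a n =
      c ^ (n + 1) / (n + 1 : ℂ) * φ x₀ := by
    intro n
    have hn1 : (n + 1 : ℂ) ≠ 0 := by exact_mod_cast n.succ_ne_zero
    simp only [ha_def, Function.comp_apply, eigenfunctional_cesaroMean_apply h]
    rw [Finset.sum_Icc_succ_top (by omega)]
    rcases eq_or_ne n 0 with rfl | hn
    · simp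
    · have hn' : (n : ℂ) ≠ 0 := by exact_mod_cast hn
      push_cast
      field_simp
      ring
  have hlim : Tendsto (fun n : ℕ => c ^ (n + 1) / (n + 1 : ℂ) * φ x₀) atTop (𝓝 0) := by
    simp_rw [← hstep]
    have := ((tendsto_add_atTop_iff_nat 1).2 ha).sub
      ((tendsto_natCast_div_add_atTop (1 : ℂ)).mul ha)
    simpa using this
  -- The reciprocal factor also tends to `0`, so the constant product `φ x₀` would have to vanish.
  have hinv : Tendsto (fun n : ℕ => (n + 1 : ℂ) / c ^ (n + 1)) atTop (𝓝 0) := by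
    rw [tendsto_zero_iff_norm_tendsto_zero]
    have := (tendsto_add_atTop_iff_nat 1).2 (tendsto_pow_const_div_const_pow_of_one_lt 1 hc)
    refine this.congr fun n => ?_
    rw [norm_div, norm_pow, pow_one]
    congr 1
    exact_mod_cast (Complex.norm_natCast (n + 1)).symm
  have hone := hlim.mul hinv
  have hconst : (fun n : ℕ => c ^ (n + 1) / (n + 1 : ℂ) * φ x₀ * ((n + 1 : ℂ) / c ^ (n + 1))) =
      fun _ => φ x₀ := by
    funext n
    have hn1 : (n + 1 : ℂ) ≠ 0 := by exact_mod_cast n.succ_ne_zero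
    field_simp
  rw [hconst, mul_zero] at hone
  exact hx₀ (tendsto_nhds_unique tendsto_const_nhds hone)

theorem IsUniformlyMeanErgodic.isMeanErgodic [ContinuousSMul ℂ E]
    (hT : IsUniformlyMeanErgodic T) : IsMeanErgodic T := by
  obtain ⟨P, hP⟩ := hT
  exact ⟨P, fun x => ((continuous_eval_const x).tendsto P).comp hP⟩

/-- An operator whose transpose has the eigenvalue `1` and an eigenvalue of modulus at least one,
with eigenfunctionals separating two vectors suitably, is not supercyclic. -/
theorem not_isSupercyclic_of_eigenfunctionals {ψ : E →L[ℂ] ℂ} (hc : 1 ≤ ‖c‖)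
    (h : ∀ x, φ (T x) = c * φ x) (hψ : ∀ x, ψ (T x) = 1 * ψ x)
    {y z : E} (hy : φ y ≠ 0) (hzφ : φ z = 0) (hzψ : ψ z ≠ 0) : ¬ IsSupercyclic T := by
  rintro ⟨x, hx⟩
  -- If `φ x = 0`, the whole projective orbit lies in the proper closed subspace `ker φ`.
  by_cases ha : φ x = 0
  · have hclosed : IsClosed {v : E | φ v = 0} := isClosed_eq φ.continuous continuous_const
    have hsub : {v : E | ∃ (n : ℕ) (d : ℂ), v = d • (T ^ n) x} ⊆ {v : E | φ v = 0} := by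
      rintro _ ⟨n, d, rfl⟩
      rw [Set.mem_ofPred_eq, map_smul, eigenfunctional_pow_apply h, ha, mul_zero, smul_zero]
    exact hy (hclosed.closure_subset_iff.2 hsub (hx y))
  -- The bound `|ψ v / φ v| ≤ |ψ x / φ x|` is cross-multiplied, so that it is a closed condition
  -- which still makes sense at `φ v = 0`. It fails at `z`.
  · have hclosed : IsClosed {v : E | ‖ψ v‖ * ‖φ x‖ ≤ ‖φ v‖ * ‖ψ x‖} :=
      isClosed_le (by fun_prop) (by fun_prop)
    have hsub : {v : E | ∃ (n : ℕ) (d : ℂ), v = d • (T ^ n) x} ⊆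
        {v : E | ‖ψ v‖ * ‖φ x‖ ≤ ‖φ v‖ * ‖ψ x‖} := by
      rintro _ ⟨n, d, rfl⟩
      simp only [Set.mem_ofPred_eq, map_smul, eigenfunctional_pow_apply h,
        eigenfunctional_pow_apply hψ, norm_smul, norm_mul, norm_pow, one_pow, one_mul]
      calc ‖d‖ * ‖ψ x‖ * ‖φ x‖ = 1 * (‖d‖ * ‖ψ x‖ * ‖φ x‖) := (one_mul _).symm
        _ ≤ ‖c‖ ^ n * (‖d‖ * ‖ψ x‖ * ‖φ x‖) := by
          gcongr
          exact one_le_pow₀ hc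
        _ = ‖d‖ * (‖c‖ ^ n * ‖φ x‖) * ‖ψ x‖ := by ring
    have hz := hclosed.closure_subset_iff.2 hsub (hx z)
    simp only [Set.mem_ofPred_eq, hzφ, norm_zero, zero_mul] at hz
    have : 0 < ‖ψ z‖ * ‖φ x‖ := mul_pos (norm_pos_iff.2 hzψ) (norm_pos_iff.2 ha)
    linarith

end Eigenfunctional

/-- A sequence whose gaps converge to `l > 0` grows at least linearly. -/
theorem exists_linear_lower_bound_of_tendsto_gap {α : ℕ → ℝ} {l : ℝ} (hl : 0 < l)
    (hα_gap : Tendsto (fun n => α (n + 1) - α n) atTop (𝓝 l)) :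
    ∃ D : ℝ, ∀ n : ℕ, l / 2 * n - D ≤ α n := by
  obtain ⟨N, hN⟩ := eventually_atTop.1 (hα_gap.eventually_const_le (half_lt_self hl))
  -- `D` absorbs the finitely many indices up to `N`, beyond which every gap is at least `l / 2`.
  obtain ⟨D, hD⟩ := ((Finset.range (N + 1)).image fun n : ℕ => l / 2 * n - α n).bddAbove
  have hD' : ∀ n ≤ N, l / 2 * n - α n ≤ D := fun n hn =>
    hD (by simpa using ⟨n, by omega, rfl⟩)
  refine ⟨D, fun n => ?_⟩
  rcases le_total n N with hn | hn
  · linarith [hD' n hn]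
  · induction n, hn using Nat.le_induction with
    | base => linarith [hD' N le_rfl]
    | succ n hn ih => push_cast; linarith [hN n hn]

/-! ### Evaluation functionals on `Λ_∞(α)` -/

namespace PowerSeriesSpace

variable {α : ℕ → ℝ}

theorem norm_apply_mul_exp_le_seminorm (x : PowerSeriesSpace α) (k : ℕ+) (n : ℕ) :
    ‖x n‖ * Real.exp ((k : ℝ) * α n) ≤ seminorm α k x := by
  refine Real.le_sqrt_of_sq_le ?_
  rw [← pssTerm_eq]
  exact (x.2 k).le_tsum n fun m _ => pssTerm_nonneg α k _ m

/-- If `α` grows at least linearly, then every geometric weight is dominated by one of the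
seminorms. -/
theorem exists_norm_apply_mul_pow_le {a D : ℝ} (ha : 0 < a) (hα : ∀ n : ℕ, a * n - D ≤ α n)
    (w : ℂ) : ∃ (k : ℕ+) (C : ℝ), 0 ≤ C ∧ ∀ (x : PowerSeriesSpace α) (n : ℕ),
      ‖x n * w ^ n‖ ≤ C * seminorm α k x * (1 / 2) ^ n := by
  -- The choice gives `e ^ (k a) ≥ k a ≥ 2 ‖w‖`; the spare factor `2` produces the summable `(1 / 2)
  -- ^ n`.
  obtain ⟨j, hj⟩ := exists_nat_gt (2 * ‖w‖ / a)
  let k : ℕ+ := j.succPNat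
  have hk : 2 * ‖w‖ ≤ Real.exp (k * a) := by
    have h1 : 2 * ‖w‖ < j * a := (div_lt_iff₀ ha).1 hj
    have h2 : ((k : ℕ) : ℝ) = j + 1 := by simp [k]
    rw [h2]
    nlinarith [Real.add_one_le_exp ((j + 1 : ℝ) * a)]
  refine ⟨k, Real.exp (k * D), (Real.exp_pos _).le, fun x n => ?_⟩
  have hw : ‖w‖ ^ n ≤ Real.exp (k * D) * Real.exp (k * α n) * (1 / 2) ^ n := by
    have h1 : (2 * ‖w‖) ^ n ≤ Real.exp (k * a) ^ n := by gcongr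
    have h2 : Real.exp (k * a) ^ n ≤ Real.exp (k * D) * Real.exp (k * α n) := by
      rw [← Real.exp_nat_mul, ← Real.exp_add]
      apply Real.exp_le_exp.2
      have hk0 : (0 : ℝ) ≤ (k : ℕ) := Nat.cast_nonneg _
      nlinarith [hα n]
    calc ‖w‖ ^ n = (2 * ‖w‖) ^ n * (1 / 2) ^ n := by rw [← mul_pow]; congr 1; ring
      _ ≤ _ := by gcongr; exact h1.trans h2
  rw [norm_mul, norm_pow]
  calc ‖x n‖ * ‖w‖ ^ n
      ≤ ‖x n‖ * (Real.exp (k * D) * Real.exp (k * α n) * (1 / 2) ^ n) := by gcongr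
    _ = Real.exp (k * D) * (‖x n‖ * Real.exp (k * α n)) * (1 / 2) ^ n := by ring
    _ ≤ _ := by gcongr; exact norm_apply_mul_exp_le_seminorm x k n

theorem summable_apply_mul_pow {a D : ℝ} (ha : 0 < a) (hα : ∀ n : ℕ, a * n - D ≤ α n)
    (w : ℂ) (x : PowerSeriesSpace α) : Summable fun n => x n * w ^ n := by
  obtain ⟨k, C, -, h⟩ := exists_norm_apply_mul_pow_le ha hα w
  exact Summable.of_norm_bounded (summable_geometric_two.mul_left _) (h x)

/-- The linear functional `x ↦ ∑ x_n w ^ n` on `Λ_∞(α)`, for `α` of at least linear growth. -/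
noncomputable def evalLin {a D : ℝ} (ha : 0 < a) (hα : ∀ n : ℕ, a * n - D ≤ α n) (w : ℂ) :
    PowerSeriesSpace α →ₗ[ℂ] ℂ where
  toFun x := ∑' n, x n * w ^ n
  map_add' x y := by
    rw [← (summable_apply_mul_pow ha hα w x).tsum_add (summable_apply_mul_pow ha hα w y)]
    exact tsum_congr fun n => add_mul (x n) (y n) (w ^ n)
  map_smul' c x := by
    rw [RingHom.id_apply, smul_eq_mul, ← tsum_mul_left]
    exact tsum_congr fun n => mul_assoc c (x n) (w ^ n)

theorem continuous_evalLin {a D : ℝ} (ha : 0 < a) (hα : ∀ n : ℕ, a * n - D ≤ α n) (w : ℂ) :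
    Continuous (evalLin ha hα w) := by
  obtain ⟨k, C, hC, h⟩ := exists_norm_apply_mul_pow_le ha hα w
  refine WithSeminorms.continuous_normedSpace_rng ℂ (withSeminorms α) _
    ⟨{k}, ⟨C * 2, by positivity⟩, fun x => ?_⟩
  rw [Finset.sup_singleton]
  have := tsum_of_norm_bounded (hasSum_geometric_two.mul_left _) (h x)
  calc ‖∑' n, x n * w ^ n‖ ≤ C * seminorm α k x * 2 := this
    _ = C * 2 * seminorm α k x := by ring

/-- The continuous linear functional `x ↦ ∑ x_n w ^ n` on `Λ_∞(α)`, for `α` of at least linear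
growth. -/
noncomputable def evalFunctional {a D : ℝ} (ha : 0 < a) (hα : ∀ n : ℕ, a * n - D ≤ α n) (w : ℂ) :
    PowerSeriesSpace α →L[ℂ] ℂ :=
  ⟨evalLin ha hα w, continuous_evalLin ha hα w⟩

/-- Shifting the coefficients of a power series multiplies it by `w`. -/
theorem evalFunctional_diffOp {a D : ℝ} (ha : 0 < a) (hα : ∀ n : ℕ, a * n - D ≤ α n) (w : ℂ)
    (r s : ℝ) (hgap : BddAbove (Set.range fun n => α (n + 1) - α n)) (x : PowerSeriesSpace α) :
    evalFunctional ha hα w (diffOp α r s hgap x) =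
      (r + s * w) * evalFunctional ha hα w x := by
  have hx := summable_apply_mul_pow ha hα w x
  have hTx := summable_apply_mul_pow ha hα w (diffOp α r s hgap x)
  have h0 : (diffOp α r s hgap x) 0 = s * 0 + r * x 0 := rfl
  have hsucc : ∀ n, (diffOp α r s hgap x) (n + 1) = s * x n + r * x (n + 1) := fun n => rfl
  change ∑' n, (diffOp α r s hgap x) n * w ^ n = (r + s * w) * ∑' n, x n * w ^ n
  have hx1 : Summable fun n => x (n + 1) * w ^ (n + 1) :=
    (summable_nat_add_iff (f := fun n => x n * w ^ n) 1).2 hx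
  rw [hTx.tsum_eq_zero_add, add_mul]
  -- Only the sum multiplied by `r` loses its first term; the one multiplied by `s w` already
  -- matches the shifted part.
  nth_rewrite 1 [hx.tsum_eq_zero_add]
  have : ∀ n, (diffOp α r s hgap x) (n + 1) * w ^ (n + 1) =
      s * w * (x n * w ^ n) + r * (x (n + 1) * w ^ (n + 1)) := fun n => by rw [hsucc]; ring
  simp_rw [this]
  rw [(hx.mul_left _).tsum_add (hx1.mul_left _), tsum_mul_left, tsum_mul_left, h0]
  ring

/-- A finitely supported sequence, as an element of `Λ_∞(α)`. -/
def ofFinsupp (f : ℕ →₀ ℂ) : PowerSeriesSpace α :=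
  ⟨f, fun k => summable_of_ne_finset_zero (s := f.support) fun n hn => by
    simp [pssTerm, Finsupp.notMem_support_iff.1 hn]⟩

theorem evalFunctional_ofFinsupp {a D : ℝ} (ha : 0 < a) (hα : ∀ n : ℕ, a * n - D ≤ α n) (w : ℂ)
    (f : ℕ →₀ ℂ) : evalFunctional ha hα w (ofFinsupp f) = f.sum fun n z => z * w ^ n :=
  tsum_eq_sum fun n hn => by
    change f n * w ^ n = 0
    rw [Finsupp.notMem_support_iff.1 hn, zero_mul]

end PowerSeriesSpace

/-! ### Failure of the four properties -/

open PowerSeriesSpace in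
theorem proposition4p12 (α : ℕ → ℝ) (hα_nonneg : ∀ n, 0 ≤ α n) (hα_mono : Monotone α)
    (hα_top : Tendsto α atTop atTop) (l : ℝ) (hl : 0 < l)
    (hα_gap : Tendsto (fun n => α (n + 1) - α n) atTop (𝓝 l))
    (r s : ℝ) (hr : r ≠ 0) (hs : s ≠ 0) :
    ¬ IsPowerBounded (diffOp α r s hα_gap.bddAbove_range) ∧
      ¬ IsMeanErgodic (diffOp α r s hα_gap.bddAbove_range) ∧
      ¬ IsUniformlyMeanErgodic (diffOp α r s hα_gap.bddAbove_range) ∧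
      ¬ IsSupercyclic (diffOp α r s hα_gap.bddAbove_range) := by
  obtain ⟨D, hD⟩ := exists_linear_lower_bound_of_tendsto_gap hl hα_gap
  have hl2 : 0 < l / 2 := half_pos hl
  have hsc : (s : ℂ) ≠ 0 := by exact_mod_cast hs
  have heig : ∀ c : ℂ, ∀ x : PowerSeriesSpace α,
      evalFunctional hl2 hD ((c - r) / s) (diffOp α r s hα_gap.bddAbove_range x) =
        c * evalFunctional hl2 hD ((c - r) / s) x := by
    intro c x
    rw [evalFunctional_diffOp]
    congr 1
    field_simp
    ring
  have h2 : (1 : ℝ) < ‖(2 : ℂ)‖ := by norm_num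
  have he : evalFunctional hl2 hD ((2 - r) / s) (ofFinsupp (Finsupp.single 0 1)) ≠ 0 := by
    simp [evalFunctional_ofFinsupp]
  have hME := not_isMeanErgodic_of_eigenfunctional h2 (heig 2) he
  refine ⟨not_isPowerBounded_of_eigenfunctional h2 (heig 2) he, hME,
    fun h => hME h.isMeanErgodic, ?_⟩
  -- The vector represents the polynomial `w - (2 - r) / s`, which vanishes at the point of
  -- eigenvalue `2` and equals `-1 / s` at the point of eigenvalue `1`.
  have hz : ∀ w : ℂ, evalFunctional hl2 hD w
      (ofFinsupp (Finsupp.single 1 1 - Finsupp.single 0 (((2 : ℂ) - r) / s))) =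
        w - (2 - r) / s := by
    intro w
    rw [evalFunctional_ofFinsupp, Finsupp.sum_sub_index fun n a b => sub_mul a b _]
    simp
  refine not_isSupercyclic_of_eigenfunctionals h2.le (heig 2) (heig 1) he
    (z := ofFinsupp (Finsupp.single 1 1 - Finsupp.single 0 (((2 : ℂ) - r) / s))) ?_ ?_
  · rw [hz, sub_self]
  · rw [hz, ← sub_div]
    exact div_ne_zero (by ring_nf; norm_num) hsc
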